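/- Conventions. $\mathbb R_+^d$ ($d\ge 1$) carries the componentwise order $\preceq$. A process $N$ indexed by $T=\mathbb R_+$ or $T=\mathbb R_+^d$ with values in $\{0,1,2,\dots\}$ is a (one-parameter, resp. $d$-parameter) counting process if $N(0)=0$ and $N(s)\le N(t)$ whenever $s\preceq t$. For $\boldsymbol\Lambda=(\lambda_1,\dots,\lambda_d)$ with all $\lambda_i>0$, a $d$-parameter counting process $\mathscr N$ is a multiparameter Poisson process (MPP) with transition parameter $\boldsymbol\Lambda$ if its increments along every chain $\mathbf t^{(0)}\preceq\dots\preceq\mathbf t^{(m)}$ are independent, $\mathscr N(\mathbf t)-\mathscr N(\mathbf s)\overset{d}{=}\mathscr N(\mathbf t-\mathbf s)$ for $\mathbf s\preceq\mathbf t$, and $\mathscr N(\mathbf t)$ has the Poisson distribution with mean $\boldsymbol\Lambda\cdot\mathbf t$; for $d=1$ this is the Poisson process with rate $\lambda_1$. For $\alpha\in(0,1)$, an inverse $\alpha$-stable subordinator is $L^\alpha(t)=\inf\{u>0:S^\alpha(u)>t\}$, $t\ge0$, where $S^\alpha$ is a subordinator with $\mathbb E e^{-wS^\alpha(t)}=e^{-tw^\alpha}$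 for all $w>0$. Let $\lambda>0$. A process is called a fractional Poisson process with index $\alpha$ and rate $\lambda$ if it has the same finite-dimensional distributions as $\{N(L^\alpha(t)),\ t\ge 0\}$, where $N$ is a Poisson process with rate $\lambda$ and $L^\alpha$ is an inverse $\alpha$-stable subordinator independent of $N$. Let $\boldsymbol\alpha=(\alpha_1,\dots,\alpha_d)\in(0,1)^d$. A process indexed by $\mathbb R^d_+$ is called a multiparameter fractional Poisson process (MFPP) with index $\boldsymbol\alpha$ and transition parameter $\boldsymbol\Lambda$ if it has the same finite-dimensional distributions as $\{\mathscr N(L_1^{\alpha_1}(t_1),\dots,L_d^{\alpha_d}(t_d)),\ \mathbf t\in\mathbb R_+^d\}$, where $\mathscr N$ is an MPP with transition parameter $\boldsymbol\Lambda$, the $L_i^{\alpha_i}$ are independent inverse $\alpha_i$-stable subordinators, and $(L_1^{\alpha_1},\dots,L_d^{\alpha_d})$ is independent of $\mathscr N$. Theorem. Let $d\ge1$, $\alpha_i\in(0,1)$ and $\lambda_i>0$ for $i=1,\dots,d$, and let $\{N_1^{\alpha_1}(t_1),\ t_1\ge0\},\dots,\{N_d^{\alpha_d}(t_d),\ t_d\ge0\}$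 be independent one-parameter counting processes on a probability space. Then the $d$-parameter counting process $$\mathscr N_{\boldsymbol\alpha}(\mathbf t)=\sum_{i=1}^d N_i^{\alpha_i}(t_i),\qquad \mathbf t=(t_1,\dots,t_d)\in\mathbb R_+^d,$$ is an MFPP with index $\boldsymbol\alpha$ and transition parameter $\boldsymbol\Lambda=(\lambda_1,\dots,\lambda_d)$ if and only if, for each $i=1,\dots,d$, $\{N_i^{\alpha_i}(t_i),\ t_i\ge0\}$ is a fractional Poisson process with index $\alpha_i$ and rate $\lambda_i$. -/

import Mathlib

open MeasureTheory ProbabilityTheory Filter Topology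
open scoped NNReal

namespace FracPoisson

/-- Two processes with the same index set, possibly living on different probability spaces, have
the same finite-dimensional distributions. -/
def SameFDD {T E Ω Ω' : Type*} [MeasurableSpace E] [MeasurableSpace Ω] [MeasurableSpace Ω']
    (X : T → Ω → E) (P : Measure Ω) (Y : T → Ω' → E) (P' : Measure Ω') : Prop :=
  ∀ I : Finset T, IdentDistrib (fun ω (t : I) => X t ω) (fun ω (t : I) => Y t ω) P P'

/-- Stationary increments: `X t - X s` and `X (t - s)` have the same law for all `s ≤ t`. -/
def HasStationaryIncrements {T E Ω : Type*} [Preorder T] [Sub T] [Sub E] [MeasurableSpace E]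
    [MeasurableSpace Ω] (X : T → Ω → E) (P : Measure Ω) : Prop :=
  ∀ s t : T, s ≤ t → IdentDistrib (fun ω => X t ω - X s ω) (X (t - s)) P P

/-- Counting processes indexed by `T`: `T = ℝ≥0` gives the one-parameter ones, and
`T = Fin d → ℝ≥0`, with its componentwise order, the `d`-parameter ones. -/
structure IsCountingProcess {T Ω : Type*} [Preorder T] [Zero T] [MeasurableSpace Ω]
    (N : T → Ω → ℕ) : Prop where
  measurable : ∀ t, Measurable (N t)
  zero : ∀ ω, N 0 ω = 0
  mono : ∀ ω, Monotone fun t => N t ω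

/-- The (one-parameter) Poisson process with transition rate `r`. Paths are monotone, so the
truncated subtraction in `ℕ` gives the true increments over `s ≤ t`. -/
structure IsPoissonProcess {Ω : Type*} [MeasurableSpace Ω]
    (N : ℝ≥0 → Ω → ℕ) (r : ℝ) (P : Measure Ω) : Prop where
  rate_pos : 0 < r
  counting : IsCountingProcess N
  indep : HasIndepIncrements N P
  stationary : HasStationaryIncrements N P
  law : ∀ (t : ℝ≥0) (n : ℕ),
    P.real {ω | N t ω = n} = (r * t) ^ n / (n.factorial : ℝ) * Real.exp (-(r * t))

/-- The multiparameter Poisson process with transition parameter `Λ`. Increments are taken along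
chains `t 0 ≤ t 1 ≤ ⋯ ≤ t m` of the componentwise order. -/
structure IsMultiparameterPoisson {Ω : Type*} [MeasurableSpace Ω] {d : ℕ}
    (N : (Fin d → ℝ≥0) → Ω → ℕ) (Λ : Fin d → ℝ) (P : Measure Ω) : Prop where
  rate_pos : ∀ i, 0 < Λ i
  counting : IsCountingProcess N
  indep : HasIndepIncrements N P
  stationary : HasStationaryIncrements N P
  law : ∀ (t : Fin d → ℝ≥0) (n : ℕ),
    P.real {ω | N t ω = n} =
      (∑ i, Λ i * t i) ^ n / (n.factorial : ℝ) * Real.exp (-(∑ i, Λ i * t i))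

/-- Subordinator: a nonnegative one-parameter Lévy process with nondecreasing paths. -/
structure IsSubordinator {Ω : Type*} [MeasurableSpace Ω]
    (S : ℝ≥0 → Ω → ℝ≥0) (P : Measure Ω) : Prop where
  measurable : ∀ t, Measurable (S t)
  zero : ∀ᵐ ω ∂P, S 0 ω = 0
  indep : HasIndepIncrements S P
  stationary : HasStationaryIncrements S P
  cadlag : ∀ᵐ ω ∂P, ∀ t : ℝ≥0,
    ContinuousWithinAt (fun u => S u ω) (Set.Ici t) t ∧
      ∃ l : ℝ≥0, Tendsto (fun u => S u ω) (𝓝[<] t) (𝓝 l)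
  stoch_cont : ∀ (u : ℕ → ℝ≥0) (t : ℝ≥0), Tendsto u atTop (𝓝 t) →
    TendstoInMeasure P (fun n => S (u n)) atTop (S t)
  mono : ∀ᵐ ω ∂P, Monotone fun t => S t ω

/-- `a`-stable subordinator: `E exp (-w S(t)) = exp (-t w ^ a)` for `w > 0`. -/
structure IsStableSubordinator {Ω : Type*} [MeasurableSpace Ω]
    (S : ℝ≥0 → Ω → ℝ≥0) (a : ℝ) (P : Measure Ω) : Prop where
  subordinator : IsSubordinator S P
  laplace : ∀ (t : ℝ≥0) (w : ℝ), 0 < w →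
    ∫ ω, Real.exp (-(w * S t ω)) ∂P = Real.exp (-(t * w ^ a))

/-- Inverse `a`-stable subordinator: the first passage time process of an `a`-stable subordinator.
(Almost surely the set of which the infimum is taken is nonempty for all `t`.) -/
structure IsInverseStableSubordinator {Ω : Type*} [MeasurableSpace Ω]
    (L : ℝ≥0 → Ω → ℝ≥0) (a : ℝ) (P : Measure Ω) : Prop where
  measurable : ∀ t, Measurable (L t)
  first_passage : ∃ S : ℝ≥0 → Ω → ℝ≥0, IsStableSubordinator S a P ∧
    ∀ t ω, L t ω = sInf {u : ℝ≥0 | 0 < u ∧ t < S u ω}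

/-- Multiparameter inverse stable subordinator `(t₁, …, t_d) ↦ (L₁(t₁), …, L_d(t_d))` with
independent inverse `α i`-stable subordinators `L i`. -/
def IsMultiparameterInverseStable {Ω : Type*} [MeasurableSpace Ω] {d : ℕ}
    (L : (Fin d → ℝ≥0) → Ω → (Fin d → ℝ≥0)) (α : Fin d → ℝ) (P : Measure Ω) : Prop :=
  ∃ l : Fin d → ℝ≥0 → Ω → ℝ≥0,
    (∀ i, IsInverseStableSubordinator (l i) (α i) P) ∧
    iIndepFun (fun i ω t => l i t ω) P ∧
    ∀ t ω i, L t ω i = l i (t i) ω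

/-- `X` is (a version in law of) the fractional Poisson process with index `a` and rate `r`: it has
the finite-dimensional distributions of `N(L(t))`, with `N` a Poisson process of rate `r` and `L`
an inverse `a`-stable subordinator independent of `N`. -/
def IsFractionalPoisson {Ω : Type*} [MeasurableSpace Ω]
    (X : ℝ≥0 → Ω → ℕ) (a r : ℝ) (P : Measure Ω) : Prop :=
  ∃ (Ω' : Type) (_ : MeasurableSpace Ω') (P' : Measure Ω') (N : ℝ≥0 → Ω' → ℕ)
    (L : ℝ≥0 → Ω' → ℝ≥0),
    IsProbabilityMeasure P' ∧
    IsPoissonProcess N r P' ∧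
    IsInverseStableSubordinator L a P' ∧
    IndepFun (fun ω t => N t ω) (fun ω t => L t ω) P' ∧
    SameFDD X P (fun t ω => N (L t ω) ω) P'

/-- `X` is (a version in law of) the multiparameter fractional Poisson process with index `α` and
transition parameter `Λ`: it has the finite-dimensional distributions of `N(L(t))`, with `N` a
multiparameter Poisson process with parameter `Λ` and `L` a multiparameter inverse stable
subordinator with index `α` independent of `N`. -/
def IsMultiparameterFractionalPoisson {Ω : Type*} [MeasurableSpace Ω] {d : ℕ}
    (X : (Fin d → ℝ≥0) → Ω → ℕ) (α Λ : Fin d → ℝ) (P : Measure Ω) : Prop :=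
  ∃ (Ω' : Type) (_ : MeasurableSpace Ω') (P' : Measure Ω') (N : (Fin d → ℝ≥0) → Ω' → ℕ)
    (L : (Fin d → ℝ≥0) → Ω' → (Fin d → ℝ≥0)),
    IsProbabilityMeasure P' ∧
    IsMultiparameterPoisson N Λ P' ∧
    IsMultiparameterInverseStable L α P' ∧
    IndepFun (fun ω t => N t ω) (fun ω t => L t ω) P' ∧
    SameFDD X P (fun t ω => N (L t ω) ω) P'

end FracPoisson

/-! Restricting to a coordinate axis gives one direction, superposition on a product space the
other.

From the sum to its summands: at `Pi.single i t` every other count is `N j 0 = 0`, so the sum is `N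
i t`. In the model `M(L(t))` the other coordinates of `L` vanish almost surely there, so what
remains is `M` along the axis run at the time `l i t`, and `M` along an axis is Poisson with rate `Λ
i` (`IsMultiparameterPoisson.axis`). An inverse stable subordinator starts at zero because `S u > 0`
almost surely for each `u > 0` (`IsStableSubordinator.ae_pos`).

Conversely, the models `(M i, l i)` of the summands live on unrelated spaces, and their product
makes the pairs independent. There `∑ i, M i (t i)` is a multiparameter Poisson process
(`isMultiparameterPoisson_sum`), independent of the vector of the `l i` (`indepFun_pi_of_indepFun`).
Substituting gives `∑ i, M i (l i (t i))`, whose summands are independent and agree in law with the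
`N i`; independence on both sides transfers this to the sums (`SameFDD.sum`). -/

namespace FracPoisson

/-! ### Generalities on independence, laws and finite-dimensional distributions -/

section General

variable {Ω Ω' : Type*} [MeasurableSpace Ω] [MeasurableSpace Ω'] {P : Measure Ω} {P' : Measure Ω'}

/-- If a family indexed by pairs is independent, then so is the family of its rows. -/
lemma iIndepFun_curry {ι : Type*} {κ : ι → Type*} {E : (i : ι) → κ i → Type*}
    [∀ i j, MeasurableSpace (E i j)] {X : (i : ι) → (j : κ i) → Ω → E i j}
    (mX : ∀ i j, Measurable (X i j))
    (h : iIndepFun (fun (p : (i : ι) × κ i) ω => X p.1 p.2 ω) P) :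
    iIndepFun (fun i ω j => X i j ω) P := by
  have := h.isProbabilityMeasure
  have hprob : ∀ i j, IsProbabilityMeasure (P.map (X i j)) :=
    fun i j => Measure.isProbabilityMeasure_map (mX i j).aemeasurable
  have hrow : ∀ i, P.map (fun ω j => X i j ω) = Measure.infinitePi fun j => P.map (X i j) := by
    intro i
    have hi : iIndepFun (X i) P := h.precomp (g := fun j : κ i => (⟨i, j⟩ : (i : ι) × κ i))
      sigma_mk_injective
    exact hi.map_fun_eq_infinitePi_map (mX i)
  rw [iIndepFun_iff_map_fun_eq_infinitePi_map (by fun_prop)]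
  simp_rw [hrow]
  -- The law of the whole family is a product over pairs; currying carries it to the product of the
  -- row products.
  rw [← Measure.infinitePi_map_piCurry (fun i j => P.map (X i j)),
    ← h.map_fun_eq_infinitePi_map (fun p => mX p.1 p.2),
    Measure.map_map (by fun_prop) (by fun_prop)]
  rfl

/-- Sums over `i` of mutually independent families `(X i j)_j` are independent in `j`, provided
each family is independent. -/
lemma iIndepFun_sum {ι κ E : Type*} [Fintype ι] [MeasurableSpace E] [AddCommMonoid E]
    [MeasurableAdd₂ E] {X : ι → κ → Ω → E} (mX : ∀ i j, Measurable (X i j))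
    (h1 : iIndepFun (fun i ω j => X i j ω) P) (h2 : ∀ i, iIndepFun (X i) P) :
    iIndepFun (fun j ω => ∑ i, X i j ω) P := by
  -- Flatten to one independent family indexed by pairs, swap the two indices, and regroup by `j`.
  have h := iIndepFun_uncurry' mX h1 h2
  have h' : iIndepFun (fun (p : (_ : κ) × ι) ω => X p.2 p.1 ω) P :=
    h.precomp (g := fun p : (_ : κ) × ι => (p.2, p.1)) (by
      rintro ⟨a, b⟩ ⟨c, d⟩ hab
      simp only [Prod.mk.injEq] at hab
      rw [hab.1, hab.2])
  have h3 := iIndepFun_curry (X := fun j i => X i j) (fun j i => mX i j) h'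
  exact h3.comp (fun _ (v : ι → E) => ∑ i, v i) (fun _ => by fun_prop)

/-- Independent families of pairs with independent components have independent components. -/
lemma indepFun_pi_of_indepFun {ι E F : Type*} [Fintype ι] [MeasurableSpace E] [MeasurableSpace F]
    {X : ι → Ω → E} {Y : ι → Ω → F} (mX : ∀ i, Measurable (X i)) (mY : ∀ i, Measurable (Y i))
    (h : iIndepFun (fun i ω => (X i ω, Y i ω)) P) (hXY : ∀ i, IndepFun (X i) (Y i) P) :
    IndepFun (fun ω i => X i ω) (fun ω i => Y i ω) P := by
  have := h.isProbabilityMeasure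
  have hpX : ∀ i, IsProbabilityMeasure (P.map (X i)) :=
    fun i => Measure.isProbabilityMeasure_map (mX i).aemeasurable
  have hpY : ∀ i, IsProbabilityMeasure (P.map (Y i)) :=
    fun i => Measure.isProbabilityMeasure_map (mY i).aemeasurable
  have hX : iIndepFun X P := h.comp (fun _ => Prod.fst) (fun _ => measurable_fst)
  have hY : iIndepFun Y P := h.comp (fun _ => Prod.snd) (fun _ => measurable_snd)
  rw [indepFun_iff_map_prod_eq_prod_map_map (by fun_prop) (by fun_prop),
    hX.map_fun_eq_pi_map (fun i => (mX i).aemeasurable),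
    hY.map_fun_eq_pi_map (fun i => (mY i).aemeasurable),
    ← (measurePreserving_arrowProdEquivProdArrow E F ι _ _).map_eq]
  simp_rw [← fun i => (hXY i).map_prod_eq_prod_map_map (mX i).aemeasurable (mY i).aemeasurable]
  rw [← h.map_fun_eq_pi_map (fun i => ((mX i).prodMk (mY i)).aemeasurable),
    Measure.map_map (MeasurableEquiv.measurable _) (by fun_prop)]
  rfl

/-- This and the transport lemmas below serve with `π` a coordinate projection of a product
probability space. -/
lemma iIndepFun_comp_measurePreserving {ι : Type*} {E : ι → Type*} [∀ i, MeasurableSpace (E i)]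
    {X : (i : ι) → Ω → E i} {π : Ω' → Ω} (mX : ∀ i, Measurable (X i))
    (hπ : MeasurePreserving π P' P) (h : iIndepFun X P) :
    iIndepFun (fun i ω => X i (π ω)) P' := by
  rw [iIndepFun_iff_measure_inter_preimage_eq_mul] at h ⊢
  intro S A hA
  have hm : ∀ i ∈ S, MeasurableSet (X i ⁻¹' A i) := fun i hi => mX i (hA i hi)
  have key := h S hA
  rw [← hπ.measure_preimage (S.measurableSet_biInter hm).nullMeasurableSet] at key
  rw [Set.preimage_iInter₂] at key
  refine key.trans (Finset.prod_congr rfl fun i hi => ?_)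
  rw [← hπ.measure_preimage (hm i hi).nullMeasurableSet]
  rfl

lemma indepFun_comp_measurePreserving {E F : Type*} [MeasurableSpace E] [MeasurableSpace F]
    {X : Ω → E} {Y : Ω → F} {π : Ω' → Ω} (mX : Measurable X) (mY : Measurable Y)
    (hπ : MeasurePreserving π P' P) (h : IndepFun X Y P) :
    IndepFun (fun ω => X (π ω)) (fun ω => Y (π ω)) P' := by
  rw [indepFun_iff_measure_inter_preimage_eq_mul] at h ⊢
  intro s t hs ht
  have key := h s t hs ht
  rw [← hπ.measure_preimage (mX hs).nullMeasurableSet,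
    ← hπ.measure_preimage (mY ht).nullMeasurableSet,
    ← hπ.measure_preimage ((mX hs).inter (mY ht)).nullMeasurableSet] at key
  exact key

lemma identDistrib_comp_measurePreserving {E : Type*} [MeasurableSpace E] {f : Ω → E} {π : Ω' → Ω}
    (hf : AEMeasurable f P) (hπ : MeasurePreserving π P' P) :
    IdentDistrib (fun ω => f (π ω)) f P' P where
  aemeasurable_fst := hf.comp_quasiMeasurePreserving hπ.quasiMeasurePreserving
  aemeasurable_snd := hf
  map_eq := by
    have h := AEMeasurable.map_map_of_aemeasurable (hπ.map_eq.symm ▸ hf) hπ.measurable.aemeasurable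
    rw [hπ.map_eq] at h
    exact h.symm

/-- Needed for the axis embedding `t ↦ Pi.single i t` and, in the converse, for the non-injective
projection `t ↦ t i`. -/
lemma SameFDD.reindex {T T' E : Type*} [MeasurableSpace E] {X : T → Ω → E} {Y : T → Ω' → E}
    (h : SameFDD X P Y P') (φ : T' → T) :
    SameFDD (fun t => X (φ t)) P (fun t => Y (φ t)) P' := by
  classical
  intro I
  let g : (I.image φ → E) → I → E := fun v t => v ⟨φ t, Finset.mem_image_of_mem φ t.2⟩
  have hg : Measurable g := measurable_pi_lambda _ fun t => measurable_pi_apply _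
  exact (h (I.image φ)).comp hg

lemma SameFDD.congr_right {T E : Type*} [MeasurableSpace E] {X : T → Ω → E} {Y Z : T → Ω' → E}
    (h : SameFDD X P Y P') (hYZ : ∀ t, Y t =ᵐ[P'] Z t) : SameFDD X P Z P' := by
  intro I
  refine (h I).trans (IdentDistrib.of_ae_eq (h I).aemeasurable_snd ?_)
  have hall : ∀ᵐ ω ∂P', ∀ t : I, Y t ω = Z t ω := ae_all_iff.2 fun t => hYZ t
  filter_upwards [hall] with ω hω
  exact funext hω

/-- Sums of independent processes are determined in law by the laws of the summands. -/
lemma SameFDD.sum {ι T E : Type*} [Fintype ι] [MeasurableSpace E] [AddCommMonoid E]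
    [MeasurableAdd₂ E] {X : ι → T → Ω → E} {Y : ι → T → Ω' → E}
    (h : ∀ i, SameFDD (X i) P (Y i) P')
    (hX : ∀ I : Finset T, iIndepFun (fun i ω (t : I) => X i t ω) P)
    (hY : ∀ I : Finset T, iIndepFun (fun i ω (t : I) => Y i t ω) P') :
    SameFDD (fun t ω => ∑ i, X i t ω) P (fun t ω => ∑ i, Y i t ω) P' := by
  intro I
  have hg : Measurable fun (v : ι → I → E) (t : I) => ∑ i, v i t := by fun_prop
  exact (IdentDistrib.pi (fun i => h i I) (hX I) (hY I)).comp hg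

/-- A variable with the Poisson probabilities has the Poisson law. -/
lemma hasLaw_poissonMeasure [IsProbabilityMeasure P] {X : Ω → ℕ} (mX : Measurable X) (r : ℝ≥0)
    (h : ∀ n : ℕ, P.real {ω | X ω = n} = (r : ℝ) ^ n / (n.factorial : ℝ) * Real.exp (-r)) :
    HasLaw X (poissonMeasure r) P where
  aemeasurable := mX.aemeasurable
  map_eq := by
    have := Measure.isProbabilityMeasure_map (μ := P) mX.aemeasurable
    refine Measure.ext_of_singleton fun n => ?_
    rw [← measureReal_eq_measureReal_iff, poissonMeasure_real_singleton,
      map_measureReal_apply mX (measurableSet_singleton n)]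
    exact (h n).trans (by ring)

lemma hasLaw_poissonMeasure_sum {ι : Type*} [IsProbabilityMeasure P] {X : ι → Ω → ℕ} {r : ι → ℝ≥0}
    (mX : ∀ i, Measurable (X i)) (hX : iIndepFun X P)
    (h : ∀ i, HasLaw (X i) (poissonMeasure (r i)) P) (s : Finset ι) :
    HasLaw (∑ i ∈ s, X i) (poissonMeasure (∑ i ∈ s, r i)) P := by
  classical
  induction s using Finset.induction_on with
  | empty =>
    simp only [Finset.sum_empty]
    -- The empty sum is Poisson with mean zero, by `0 ^ 0 = 1`.
    refine hasLaw_poissonMeasure measurable_zero 0 fun n => ?_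
    rcases n with _ | n <;> simp
  | insert i s hi ih =>
    rw [Finset.sum_insert hi, Finset.sum_insert hi]
    exact (hX.indepFun_finsetSum_of_notMem mX hi).symm.hasLaw_add_poissonMeasure (h i) ih

end General

/-! ### Transport along measure preserving maps -/

section Transport

variable {Ω Ω' : Type*} [MeasurableSpace Ω] [MeasurableSpace Ω'] {P : Measure Ω} {P' : Measure Ω'}
  {π : Ω' → Ω}

lemma hasIndepIncrements_comp_measurePreserving {T E : Type*} [Preorder T] [MeasurableSpace E]
    [Sub E] [MeasurableSub₂ E] {X : T → Ω → E} (mX : ∀ t, Measurable (X t))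
    (hπ : MeasurePreserving π P' P) (h : HasIndepIncrements X P) :
    HasIndepIncrements (fun t ω => X t (π ω)) P' := fun n t ht =>
  iIndepFun_comp_measurePreserving (fun _ => (mX _).sub (mX _)) hπ (h n t ht)

lemma HasStationaryIncrements.comp_measurePreserving {T E : Type*} [Preorder T] [Sub T]
    [MeasurableSpace E] [Sub E] {X : T → Ω → E}
    (hπ : MeasurePreserving π P' P) (h : HasStationaryIncrements X P) :
    HasStationaryIncrements (fun t ω => X t (π ω)) P' := fun s t hst =>
  ((identDistrib_comp_measurePreserving (h s t hst).aemeasurable_fst hπ).trans (h s t hst)).trans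
    (identDistrib_comp_measurePreserving (h s t hst).aemeasurable_snd hπ).symm

lemma IsSubordinator.comp_measurePreserving {S : ℝ≥0 → Ω → ℝ≥0} (hπ : MeasurePreserving π P' P)
    (h : IsSubordinator S P) : IsSubordinator (fun t ω => S t (π ω)) P' where
  measurable t := (h.measurable t).comp hπ.measurable
  zero := hπ.quasiMeasurePreserving.ae h.zero
  indep := hasIndepIncrements_comp_measurePreserving h.measurable hπ h.indep
  stationary := h.stationary.comp_measurePreserving hπ
  cadlag := hπ.quasiMeasurePreserving.ae h.cadlag
  stoch_cont u t hu ε hε := by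
    refine (h.stoch_cont u t hu ε hε).congr fun n => ?_
    have hm : MeasurableSet {ω | ε ≤ edist (S (u n) ω) (S t ω)} :=
      measurableSet_le measurable_const ((h.measurable (u n)).edist (h.measurable t))
    exact (hπ.measure_preimage hm.nullMeasurableSet).symm
  mono := hπ.quasiMeasurePreserving.ae h.mono

lemma IsStableSubordinator.comp_measurePreserving {S : ℝ≥0 → Ω → ℝ≥0} {a : ℝ}
    (hπ : MeasurePreserving π P' P) (h : IsStableSubordinator S a P) :
    IsStableSubordinator (fun t ω => S t (π ω)) a P' where
  subordinator := h.subordinator.comp_measurePreserving hπ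
  laplace t w hw := by
    have mS := h.subordinator.measurable t
    rw [← h.laplace t w hw]
    exact (identDistrib_comp_measurePreserving (f := fun ω => Real.exp (-(w * S t ω)))
      (Measurable.aemeasurable (by fun_prop)) hπ).integral_eq

lemma IsInverseStableSubordinator.comp_measurePreserving {L : ℝ≥0 → Ω → ℝ≥0} {a : ℝ}
    (hπ : MeasurePreserving π P' P) (h : IsInverseStableSubordinator L a P) :
    IsInverseStableSubordinator (fun t ω => L t (π ω)) a P' where
  measurable t := (h.measurable t).comp hπ.measurable
  first_passage := by
    obtain ⟨S, hS, hL⟩ := h.first_passage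
    exact ⟨fun t ω => S t (π ω), hS.comp_measurePreserving hπ, fun t ω => hL t (π ω)⟩

end Transport

/-! ### Inverse stable subordinators start at zero -/

section Inverse

variable {Ω : Type*} [MeasurableSpace Ω] {P : Measure Ω} [IsProbabilityMeasure P]

/-- The atom at zero is bounded by the Laplace transform `exp (-(u * w ^ a))`, which tends to `0` as
`w → ∞` since `a > 0` and `u > 0`. -/
lemma IsStableSubordinator.ae_pos {S : ℝ≥0 → Ω → ℝ≥0} {a : ℝ} (ha : 0 < a)
    (h : IsStableSubordinator S a P) {u : ℝ≥0} (hu : 0 < u) : ∀ᵐ ω ∂P, 0 < S u ω := by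
  have mS := h.subordinator.measurable u
  have hle : ∀ w : ℝ, 0 < w → P.real {ω | S u ω = 0} ≤ Real.exp (-(u * w ^ a)) := by
    intro w hw
    have hint : Integrable (fun ω => Real.exp (-(w * S u ω))) P := by
      refine Integrable.of_bound (Measurable.aestronglyMeasurable (by fun_prop)) 1
        (.of_forall fun ω => ?_)
      rw [Real.norm_eq_abs, Real.abs_exp, Real.exp_le_one_iff, neg_nonpos]
      positivity
    -- Markov's inequality at level `1`, the value of the exponential where `S u = 0`.
    have hM := mul_meas_ge_le_integral_of_nonneg
      (.of_forall fun ω => (Real.exp_pos (-(w * S u ω))).le) hint 1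
    rw [one_mul, h.laplace u w hw] at hM
    refine le_trans (measureReal_mono fun ω hω => ?_) hM
    simp only [Set.mem_ofPred_eq] at hω ⊢
    simp [hω]
  have hlim : Tendsto (fun w : ℝ => Real.exp (-(u * w ^ a))) atTop (𝓝 0) :=
    Real.tendsto_exp_neg_atTop_nhds_zero.comp
      ((tendsto_rpow_atTop ha).const_mul_atTop (NNReal.coe_pos.2 hu))
  have h0 : P.real {ω | S u ω = 0} ≤ 0 :=
    ge_of_tendsto hlim ((eventually_gt_atTop 0).mono hle)
  have h1 : P {ω | S u ω = 0} = 0 := by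
    rw [← measureReal_eq_zero_iff]
    exact le_antisymm h0 measureReal_nonneg
  filter_upwards [measure_eq_zero_iff_ae_notMem.1 h1] with ω hω
  exact pos_iff_ne_zero.2 hω

/-- Almost surely all the times `1 / (n + 1)` belong to the set whose infimum is `L 0`; countably
many times suffice. -/
lemma IsInverseStableSubordinator.ae_zero {L : ℝ≥0 → Ω → ℝ≥0} {a : ℝ} (ha : 0 < a)
    (h : IsInverseStableSubordinator L a P) : ∀ᵐ ω ∂P, L 0 ω = 0 := by
  obtain ⟨S, hS, hL⟩ := h.first_passage
  have hpos : ∀ᵐ ω ∂P, ∀ n : ℕ, 0 < S (1 / ((n : ℝ≥0) + 1)) ω :=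
    ae_all_iff.2 fun n => hS.ae_pos ha (by positivity)
  filter_upwards [hpos] with ω hω
  rw [hL]
  refine le_antisymm (ge_of_tendsto' (tendsto_one_div_add_atTop_nhds_zero_nat (𝕜 := ℝ≥0))
    fun n => ?_) zero_le
  exact csInf_le (OrderBot.bddBelow _) ⟨by positivity, hω n⟩

end Inverse

/-! ### Multiparameter Poisson processes and their axes -/

section Poisson

variable {Ω : Type*} [MeasurableSpace Ω] {P : Measure Ω} {d : ℕ}

lemma monotone_single (i : Fin d) : Monotone fun t : ℝ≥0 => (Pi.single i t : Fin d → ℝ≥0) :=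
  fun _ _ h => Pi.single_le_single.2 h

/-- Along a coordinate axis, a multiparameter Poisson process is a Poisson process. -/
lemma IsMultiparameterPoisson.axis {N : (Fin d → ℝ≥0) → Ω → ℕ} {Λ : Fin d → ℝ}
    (h : IsMultiparameterPoisson N Λ P) (i : Fin d) :
    IsPoissonProcess (fun t => N (Pi.single i t)) (Λ i) P where
  rate_pos := h.rate_pos i
  counting :=
    { measurable := fun t => h.counting.measurable _
      zero := fun ω => by rw [Pi.single_zero]; exact h.counting.zero ω
      mono := fun ω => (h.counting.mono ω).comp (monotone_single i) }
  indep n t ht := h.indep n (fun k => Pi.single i (t k)) ((monotone_single i).comp ht)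
  stationary s t hst := by
    have hs := h.stationary _ _ (monotone_single i hst)
    have hsub : (Pi.single i t - Pi.single i s : Fin d → ℝ≥0) = Pi.single i (t - s) := by
      ext j
      rcases eq_or_ne j i with rfl | hj
      · simp
      · simp [hj]
    rwa [hsub] at hs
  law t n := by
    have hsum : ∑ j, Λ j * ((Pi.single i t : Fin d → ℝ≥0) j : ℝ) = Λ i * t := by
      rw [Finset.sum_eq_single i]
      · simp
      · intro j _ hj
        simp [hj]
      · simp
    have hl := h.law (Pi.single i t) n
    rwa [hsum] at hl

/-- Sums of independent counting processes in separate parameters have increments equal to the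
sums of the increments. -/
lemma sum_sub_sum_eq {N : Fin d → ℝ≥0 → Ω → ℕ} (hN : ∀ i, IsCountingProcess (N i))
    {s t : Fin d → ℝ≥0} (hst : s ≤ t) (ω : Ω) :
    ∑ i, N i (t i) ω - ∑ i, N i (s i) ω = ∑ i, (N i (t i) ω - N i (s i) ω) :=
  (Finset.sum_tsub_distrib _ fun i _ => (hN i).mono ω (hst i)).symm

/-- A sum of independent Poisson processes in separate parameters is a multiparameter Poisson
process. -/
lemma isMultiparameterPoisson_sum [IsProbabilityMeasure P] {N : Fin d → ℝ≥0 → Ω → ℕ}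
    {Λ : Fin d → ℝ} (hN : ∀ i, IsPoissonProcess (N i) (Λ i) P)
    (hindep : iIndepFun (fun i ω t => N i t ω) P) :
    IsMultiparameterPoisson (fun (t : Fin d → ℝ≥0) ω => ∑ i, N i (t i) ω) Λ P where
  rate_pos i := (hN i).rate_pos
  counting :=
    { measurable := fun t => Finset.measurable_sum _ fun i _ => (hN i).counting.measurable (t i)
      zero := fun ω => Finset.sum_eq_zero fun i _ => (hN i).counting.zero ω
      mono := fun ω _ _ hst => Finset.sum_le_sum fun i _ => (hN i).counting.mono ω (hst i) }
  indep n t ht := by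
    have hcoord : ∀ i, Monotone fun k => t k i := fun i _ _ hkl => ht hkl i
    have hstep : ∀ k : Fin n, t k.castSucc ≤ t k.succ := fun k => ht k.castSucc_le_succ
    simp_rw [fun (k : Fin n) ω => sum_sub_sum_eq (fun i => (hN i).counting) (hstep k) ω]
    -- Across `i` the increments are independent by `hindep`; for fixed `i` they are increments
    -- along the monotone chain of `i`-th coordinates.
    refine iIndepFun_sum
      (X := fun i (k : Fin n) ω => N i (t k.succ i) ω - N i (t k.castSucc i) ω)
      (fun i k => ((hN i).counting.measurable _).sub ((hN i).counting.measurable _)) ?_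
      (fun i => (hN i).indep n _ (hcoord i))
    exact hindep.comp
      (fun i (x : ℝ≥0 → ℕ) (k : Fin n) => x (t k.succ i) - x (t k.castSucc i))
      (fun i => by fun_prop)
  stationary s t hst := by
    simp_rw [sum_sub_sum_eq (fun i => (hN i).counting) hst]
    have hg : Measurable fun v : Fin d → ℕ => ∑ i, v i := by fun_prop
    exact (IdentDistrib.pi (fun i => (hN i).stationary _ _ (hst i))
      (hindep.comp (fun i (x : ℝ≥0 → ℕ) => x (t i) - x (s i)) (fun i => by fun_prop))
      (hindep.comp (fun i (x : ℝ≥0 → ℕ) => x (t i - s i)) (fun i => by fun_prop))).comp hg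
  law t n := by
    have hr : ∀ i, ((Real.toNNReal (Λ i) * t i : ℝ≥0) : ℝ) = Λ i * t i := fun i => by
      rw [NNReal.coe_mul, Real.coe_toNNReal _ (hN i).rate_pos.le]
    have hlaw := hasLaw_poissonMeasure_sum (X := fun i => N i (t i))
      (r := fun i => Real.toNNReal (Λ i) * t i) (fun i => (hN i).counting.measurable _)
      (hindep.comp (fun i (x : ℝ≥0 → ℕ) => x (t i)) (fun i => by fun_prop))
      (fun i => hasLaw_poissonMeasure ((hN i).counting.measurable _) _ fun n => by
        rw [hr]; exact (hN i).law (t i) n) Finset.univ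
    have hn := hlaw.measureReal_eq (p := fun m => m = n) (measurableSet_singleton n)
    simp only [Finset.sum_apply, Set.ofPred_eq_eq_singleton] at hn
    rw [hn, poissonMeasure_real_singleton, NNReal.coe_sum]
    simp_rw [hr]
    ring

end Poisson

/-! ### The two implications -/

section Main

variable {Ω : Type*} [MeasurableSpace Ω] {P : Measure Ω} {d : ℕ} {α Λ : Fin d → ℝ}
  {N : Fin d → ℝ≥0 → Ω → ℕ}

lemma isFractionalPoisson_of_sum (hα : ∀ i, 0 < α i) (hN : ∀ i, IsCountingProcess (N i))
    (h : IsMultiparameterFractionalPoisson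
      (fun (t : Fin d → ℝ≥0) ω => ∑ i, N i (t i) ω) α Λ P) (i : Fin d) :
    IsFractionalPoisson (N i) (α i) (Λ i) P := by
  obtain ⟨Ω', _, P', M, L, _, hM, ⟨l, hl, -, hL⟩, hML, hfdd⟩ := h
  refine ⟨Ω', _, P', fun t => M (Pi.single i t), l i, inferInstance, hM.axis i, hl i, ?_, ?_⟩
  · have h1 := hML.comp (φ := fun (x : (Fin d → ℝ≥0) → ℕ) (t : ℝ≥0) => x (Pi.single i t))
      (ψ := fun (y : (Fin d → ℝ≥0) → Fin d → ℝ≥0) (t : ℝ≥0) => y (Pi.single i t) i)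
      (by fun_prop) (by fun_prop)
    -- `l i` is a measurable function of the field `L`: its `i`-th coordinate along the `i`-th axis.
    have h2 : (fun ω t => l i t ω) =
        (fun (y : (Fin d → ℝ≥0) → Fin d → ℝ≥0) (t : ℝ≥0) => y (Pi.single i t) i) ∘
          fun ω t => L t ω := by
      funext ω t
      simp [hL]
    rw [h2]
    exact h1
  · have hX : (fun (t : ℝ≥0) ω => ∑ j, N j ((Pi.single i t : Fin d → ℝ≥0) j) ω) = N i := by
      funext t ω
      rw [Finset.sum_eq_single i]
      · simp
      · intro j _ hj
        rw [Pi.single_eq_of_ne hj]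
        exact (hN j).zero ω
      · simp
    have hre := hfdd.reindex fun t : ℝ≥0 => (Pi.single i t : Fin d → ℝ≥0)
    rw [hX] at hre
    refine hre.congr_right fun t => ?_
    -- The off-axis clocks vanish at time zero only almost surely, so the model is identified up to
    -- null sets.
    have hzero : ∀ᵐ ω ∂P', ∀ j, l j 0 ω = 0 := ae_all_iff.2 fun j => (hl j).ae_zero (hα j)
    filter_upwards [hzero] with ω hω
    have hLt : L (Pi.single i t) ω = Pi.single i (l i t ω) := by
      funext j
      rw [hL]
      rcases eq_or_ne j i with rfl | hj
      · simp
      · rw [Pi.single_eq_of_ne hj, Pi.single_eq_of_ne hj, hω]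
    rw [hLt]

lemma isMultiparameterFractionalPoisson_sum (hindep : iIndepFun (fun i ω t => N i t ω) P)
    (h : ∀ i, IsFractionalPoisson (N i) (α i) (Λ i) P) :
    IsMultiparameterFractionalPoisson
      (fun (t : Fin d → ℝ≥0) ω => ∑ i, N i (t i) ω) α Λ P := by
  choose Ω' mΩ' P' M l hP' hM hl hMl hfdd using h
  have hπ := fun i => measurePreserving_eval P' i
  have mM : ∀ i, Measurable fun ω t => M i t ω :=
    fun i => measurable_pi_lambda _ fun t => (hM i).counting.measurable t
  have ml : ∀ i, Measurable fun ω t => l i t ω :=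
    fun i => measurable_pi_lambda _ fun t => (hl i).measurable t
  have hMpi : iIndepFun (fun i (ω : ∀ i, Ω' i) t => M i t (ω i)) (Measure.pi P') :=
    iIndepFun_pi fun i => (mM i).aemeasurable
  have hlpi : iIndepFun (fun i (ω : ∀ i, Ω' i) t => l i t (ω i)) (Measure.pi P') :=
    iIndepFun_pi fun i => (ml i).aemeasurable
  refine ⟨∀ i, Ω' i, inferInstance, Measure.pi P',
    fun t (ω : ∀ i, Ω' i) => ∑ i, M i (t i) (ω i),
    fun t (ω : ∀ i, Ω' i) i => l i (t i) (ω i), inferInstance,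
    isMultiparameterPoisson_sum (N := fun i t (ω : ∀ i, Ω' i) => M i t (ω i)) (fun i => ?_) hMpi,
    ⟨fun i t (ω : ∀ i, Ω' i) => l i t (ω i), fun i => (hl i).comp_measurePreserving (hπ i), hlpi,
      fun _ _ _ => rfl⟩, ?_, ?_⟩
  · exact
      { rate_pos := (hM i).rate_pos
        counting :=
          { measurable := fun t => ((hM i).counting.measurable t).comp (hπ i).measurable
            zero := fun ω => (hM i).counting.zero (ω i)
            mono := fun ω => (hM i).counting.mono (ω i) }
        indep := hasIndepIncrements_comp_measurePreserving (hM i).counting.measurable (hπ i)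
          (hM i).indep
        stationary := (hM i).stationary.comp_measurePreserving (hπ i)
        law := fun t n => by
          rw [← (hM i).law t n]
          exact congrArg ENNReal.toReal ((hπ i).measure_preimage
            ((hM i).counting.measurable t (measurableSet_singleton n)).nullMeasurableSet) }
  -- The pairs `(M i, l i)` are independent by the product construction and each has independent
  -- components, so the two vectors of paths are independent; both fields are measurable functions
  -- of them.
  · have h1 := indepFun_pi_of_indepFun (P := Measure.pi P')
      (X := fun i (ω : ∀ i, Ω' i) t => M i t (ω i)) (Y := fun i (ω : ∀ i, Ω' i) t => l i t (ω i))
      (fun i => (mM i).comp (measurable_pi_apply i)) (fun i => (ml i).comp (measurable_pi_apply i))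
      (iIndepFun_pi (X := fun i (ω : Ω' i) => (fun t => M i t ω, fun t => l i t ω))
        fun i => ((mM i).prodMk (ml i)).aemeasurable)
      (fun i => indepFun_comp_measurePreserving (mM i) (ml i) (hπ i) (hMl i))
    exact h1.comp
      (φ := fun (x : Fin d → ℝ≥0 → ℕ) (t : Fin d → ℝ≥0) => ∑ i, x i (t i))
      (ψ := fun (y : Fin d → ℝ≥0 → ℝ≥0) (t : Fin d → ℝ≥0) i => y i (t i))
      (by fun_prop) (by fun_prop)
  · refine SameFDD.sum (X := fun i (t : Fin d → ℝ≥0) ω => N i (t i) ω)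
      (Y := fun i (t : Fin d → ℝ≥0) (ω : ∀ i, Ω' i) => M i (l i (t i) (ω i)) (ω i))
      (fun i I => ?_) (fun I => ?_) (fun I => ?_)
    · have hi := (hfdd i).reindex (fun t : Fin d → ℝ≥0 => t i) I
      exact hi.trans (identDistrib_comp_measurePreserving hi.aemeasurable_snd (hπ i)).symm
    · exact hindep.comp (fun i (x : ℝ≥0 → ℕ) (t : I) => x (t.1 i)) (fun i => by fun_prop)
    -- Measurability of the time-changed process is part of the identity in law `hfdd`.
    · exact iIndepFun_pi (X := fun i (ω : Ω' i) (t : I) => M i (l i (t.1 i) ω) ω)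
        fun i => ((hfdd i).reindex (fun t : Fin d → ℝ≥0 => t i) I).aemeasurable_snd

end Main

end FracPoisson

theorem mainTheorem7 {Ω : Type*} [MeasurableSpace Ω] (P : Measure Ω) [IsProbabilityMeasure P]
    (d : ℕ) (hd : 1 ≤ d) (α Λ : Fin d → ℝ)
    (hα : ∀ i, 0 < α i ∧ α i < 1) (hΛ : ∀ i, 0 < Λ i)
    (N : Fin d → ℝ≥0 → Ω → ℕ)
    (hN : ∀ i, FracPoisson.IsCountingProcess (N i))
    (hindep : iIndepFun (fun i ω t => N i t ω) P) :
    FracPoisson.IsMultiparameterFractionalPoisson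
        (fun (t : Fin d → ℝ≥0) ω => ∑ i, N i (t i) ω) α Λ P ↔
      ∀ i, FracPoisson.IsFractionalPoisson (N i) (α i) (Λ i) P :=
  ⟨fun h i => FracPoisson.isFractionalPoisson_of_sum (fun i => (hα i).1) hN h i,
    fun h => FracPoisson.isMultiparameterFractionalPoisson_sum hindep h⟩
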